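/- Let $n\ge 2$ and let $\mathbb{C}(S_n)$ be the complex group algebra of $S_n$. For $(\alpha_1,\alpha_2)\in S_n\times S_n$ put $$E_{\alpha_1,\alpha_2}=\frac1{n!}\sum_{\mu\in S_n}\mu\alpha_1\mu^{-1}\otimes\mu\alpha_2\mu^{-1}\in\mathbb{C}(S_n)\otimes\mathbb{C}(S_n),$$ which depends only on the orbit of $(\alpha_1,\alpha_2)$ under simultaneous conjugation, and let $\mathcal{K}(n)$ be the complex span of these elements. For $2\le k\le n$ let $\mathcal{C}_k\subset S_n$ be the conjugacy class of the $k$-cycles, $T_k=\sum_{\sigma\in\mathcal{C}_k}\sigma$, and $$T_k^{(1)}=T_k\otimes 1,\qquad T_k^{(2)}=1\otimes T_k,\qquad T_k^{(3)}=\sum_{\sigma\in\mathcal{C}_k}\sigma\otimes\sigma .$$ Let $R_1,R_2,R_3$ be irreducible complex representations of $S_n$ (labelled, up to isomorphism, by Young diagrams with $n$ boxes), of dimensions $d(R_i)$, with characters $\chi_{R_i}$ extended linearly to $\mathbb{C}(S_n)$, and with matrix elements $D^{R_i}_{ab}(\sigma)$ in orthonormal bases for invariant inner products. Let $C(R_1,R_2,R_3)$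 be the multiplicity of $R_3$ in $R_1\otimes R_2$ (the Kronecker coefficient), and for $1\le\tau\le C(R_1,R_2,R_3)$ let $C^{R_1,R_2;R_3,\tau}_{i_1,i_2;i_3}\in\mathbb{C}$ be Clebsch-Gordan coefficients, that is, numbers with $$\sum_{j_1,j_2}D^{R_1}_{i_1j_1}(\gamma)D^{R_2}_{i_2j_2}(\gamma)\,C^{R_1,R_2;R_3,\tau}_{j_1,j_2;j_3}=\sum_{i_3}C^{R_1,R_2;R_3,\tau}_{i_1,i_2;i_3}D^{R_3}_{i_3j_3}(\gamma)\quad(\gamma\in S_n),$$ $$\sum_{i_1,i_2}\overline{C^{R_1,R_2;R_3,\tau}_{i_1,i_2;i_3}}\;C^{R_1,R_2;R_3,\tau'}_{i_1,i_2;j_3}=\delta_{\tau\tau'}\delta_{i_3j_3}.$$ For $1\le\tau_1,\tau_2\le C(R_1,R_2,R_3)$ define the Fourier basis element $$Q^{R_1,R_2,R_3}_{\tau_1,\tau_2}=\frac{d(R_1)d(R_2)}{(n!)^2}\sum_{\sigma_1,\sigma_2\in S_n}\ \sum_{i_1,i_2,i_3,j_1,j_2}\overline{C^{R_1,R_2;R_3,\tau_1}_{i_1,i_2;i_3}}\;C^{R_1,R_2;R_3,\tau_2}_{j_1,j_2;i_3}\,D^{R_1}_{i_1j_1}(\sigma_1)\,D^{R_2}_{i_2j_2}(\sigma_2)\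 \sigma_1\otimes\sigma_2 .$$ (The complex conjugation can be omitted when the matrix elements and the Clebsch-Gordan coefficients are real, which can always be arranged.) Then for all $k\in\{2,\dots,n\}$, $i\in\{1,2,3\}$, $R_1,R_2,R_3$ and $\tau_1,\tau_2$ as above, left multiplication by $T_k^{(i)}$ maps $\mathcal{K}(n)$ to itself, $Q^{R_1,R_2,R_3}_{\tau_1,\tau_2}$ is a non-zero element of $\mathcal{K}(n)$, and it is an eigenvector of this operator: $$T_k^{(i)}\,Q^{R_1,R_2,R_3}_{\tau_1,\tau_2}=\frac{\chi_{R_i}(T_k)}{d(R_i)}\,Q^{R_1,R_2,R_3}_{\tau_1,\tau_2}.$$ -/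

import Mathlib

open scoped TensorProduct

noncomputable section

namespace RibbonAlgebra

/-- The complex group algebra `ℂ(S_n)`. -/
abbrev GroupAlg (n : ℕ) : Type := MonoidAlgebra ℂ (Equiv.Perm (Fin n))

/-- A permutation, seen as a basis element of `ℂ(S_n)`. -/
abbrev perm {n : ℕ} (σ : Equiv.Perm (Fin n)) : GroupAlg n :=
  MonoidAlgebra.of ℂ (Equiv.Perm (Fin n)) σ

/-! ### The algebra of bipartite ribbon graphs -/

/-- The element `E_r = (1/n!) ∑_μ μ τ₁ μ⁻¹ ⊗ μ τ₂ μ⁻¹` attached to the ribbon graph `r` which is the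
orbit of the pair `(τ₁, τ₂)` under simultaneous conjugation. It depends only on the orbit. -/
def ribbonElement (n : ℕ) (τ₁ τ₂ : Equiv.Perm (Fin n)) : GroupAlg n ⊗[ℂ] GroupAlg n :=
  (1 / (n.factorial : ℂ)) •
    ∑ μ : Equiv.Perm (Fin n), perm (μ * τ₁ * μ⁻¹) ⊗ₜ[ℂ] perm (μ * τ₂ * μ⁻¹)

/-- `𝒦(n)`, the complex span of all the `E_r` in `ℂ(S_n) ⊗ ℂ(S_n)`. -/
def ribbonAlgebra (n : ℕ) : Submodule ℂ (GroupAlg n ⊗[ℂ] GroupAlg n) :=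
  Submodule.span ℂ (Set.range fun τ : Equiv.Perm (Fin n) × Equiv.Perm (Fin n) =>
    ribbonElement n τ.1 τ.2)

/-! ### The operators `T_k^{(i)}` -/

/-- The conjugacy class `𝒞_k` of `S_n`: one cycle of length `k`, all other cycles of length one.
(`Equiv.Perm.cycleType` lists only the lengths of the nontrivial cycles, so this is meant for
`2 ≤ k`.) -/
def cycleClass (n k : ℕ) : Finset (Equiv.Perm (Fin n)) :=
  Finset.univ.filter fun σ => σ.cycleType = {k}

/-- `T_k`, the sum of the permutations in `𝒞_k`. -/
def cycleSum (n k : ℕ) : GroupAlg n := ∑ σ ∈ cycleClass n k, perm σ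

/-- `T_k^{(1)} = T_k ⊗ 1`, `T_k^{(2)} = 1 ⊗ T_k`, `T_k^{(3)} = ∑_{σ ∈ 𝒞_k} σ ⊗ σ`; the indices
`1, 2, 3` are the elements `0, 1, 2` of `Fin 3`. -/
def reconnection (n k : ℕ) : Fin 3 → GroupAlg n ⊗[ℂ] GroupAlg n :=
  ![cycleSum n k ⊗ₜ[ℂ] 1, 1 ⊗ₜ[ℂ] cycleSum n k, ∑ σ ∈ cycleClass n k, perm σ ⊗ₜ[ℂ] perm σ]

/-! ### Irreducible representations in orthonormal bases -/

/-- The representation on `ℂ^d` given by unitary matrices. -/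
def matrixRep {n d : ℕ} (D : Equiv.Perm (Fin n) →* Matrix.unitaryGroup (Fin d) ℂ) :
    Representation ℂ (Equiv.Perm (Fin n)) (Fin d → ℂ) :=
  ((Matrix.toLinAlgEquiv' :
      Matrix (Fin d) (Fin d) ℂ ≃ₐ[ℂ] ((Fin d → ℂ) →ₗ[ℂ] (Fin d → ℂ))) :
      Matrix (Fin d) (Fin d) ℂ →* ((Fin d → ℂ) →ₗ[ℂ] (Fin d → ℂ))).comp
    ((Matrix.unitaryGroup (Fin d) ℂ).subtype.comp D)

/-- A complex irreducible representation of `S_n`, written in an orthonormal basis for an invariant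
inner product, that is, through unitary matrices. -/
structure UnitaryIrrep (n : ℕ) where
  /-- The dimension `d(R)`. -/
  dim : ℕ
  /-- The unitary matrices `D^R(σ)`. -/
  D : Equiv.Perm (Fin n) →* Matrix.unitaryGroup (Fin dim) ℂ
  irreducible : (matrixRep D).IsIrreducible

namespace UnitaryIrrep

variable {n : ℕ}

/-- The underlying representation of `S_n`. -/
def rep (R : UnitaryIrrep n) : Representation ℂ (Equiv.Perm (Fin n)) (Fin R.dim → ℂ) :=
  matrixRep R.D

/-- The matrix element `D^R_{ij}(σ)`. -/
def entry (R : UnitaryIrrep n) (σ : Equiv.Perm (Fin n)) (i j : Fin R.dim) : ℂ :=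
  (R.D σ : Matrix (Fin R.dim) (Fin R.dim) ℂ) i j

/-- The character `χ_R`, extended linearly to `ℂ(S_n)`. -/
def char (R : UnitaryIrrep n) (x : GroupAlg n) : ℂ :=
  LinearMap.trace ℂ (Fin R.dim → ℂ) (R.rep.asAlgebraHom x)

end UnitaryIrrep

/-- The Kronecker coefficient `C(R₁, R₂, R₃)`: the multiplicity of the irrep `R₃` in `R₁ ⊗ R₂`,
i.e. the dimension of the multiplicity space `Hom_{S_n}(R₃, R₁ ⊗ R₂)`. -/
def kroneckerCoeff {n : ℕ} (R₁ R₂ R₃ : UnitaryIrrep n) : ℕ :=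
  Module.finrank ℂ (Representation.IntertwiningMap R₃.rep (R₁.rep.tprod R₂.rep))

/-- The numbers `C τ i₁ i₂ i₃ = C^{R₁,R₂;R₃,τ}_{i₁,i₂;i₃}`, where `τ` runs over `C(R₁, R₂, R₃)`
values, are Clebsch-Gordan coefficients: for each `τ` they are the matrix of an intertwiner from
`R₃` to `R₁ ⊗ R₂`, and the vectors `∑ C τ i₁ i₂ i₃ e_{i₁} ⊗ e_{i₂}` are orthonormal. So the index
`τ` runs over an orthonormal basis of the multiplicity space of `R₃` in `R₁ ⊗ R₂`. -/
structure IsClebschGordan {n : ℕ} (R₁ R₂ R₃ : UnitaryIrrep n)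
    (C : Fin (kroneckerCoeff R₁ R₂ R₃) → Fin R₁.dim → Fin R₂.dim → Fin R₃.dim → ℂ) : Prop where
  intertwines : ∀ τ (γ : Equiv.Perm (Fin n)) i₁ i₂ j₃,
    ∑ j₁, ∑ j₂, R₁.entry γ i₁ j₁ * R₂.entry γ i₂ j₂ * C τ j₁ j₂ j₃ =
      ∑ i₃, C τ i₁ i₂ i₃ * R₃.entry γ i₃ j₃
  orthonormal : ∀ τ τ' i₃ j₃,
    ∑ i₁, ∑ i₂, star (C τ i₁ i₂ i₃) * C τ' i₁ i₂ j₃ = if τ = τ' ∧ i₃ = j₃ then 1 else 0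

/-- The Fourier basis element `Q^{R₁,R₂,R₃}_{τ₁,τ₂}`, with normalization
`κ = d(R₁) d(R₂) / (n!)²`. The complex conjugation on the first coefficient has no effect when the
bases are such that the representation matrices and Clebsch-Gordan coefficients are real. -/
def fourierElement {n : ℕ} (R₁ R₂ R₃ : UnitaryIrrep n)
    (C : Fin (kroneckerCoeff R₁ R₂ R₃) → Fin R₁.dim → Fin R₂.dim → Fin R₃.dim → ℂ)
    (τ₁ τ₂ : Fin (kroneckerCoeff R₁ R₂ R₃)) : GroupAlg n ⊗[ℂ] GroupAlg n :=
  ((R₁.dim : ℂ) * (R₂.dim : ℂ) / (n.factorial : ℂ) ^ 2) •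
    ∑ σ₁ : Equiv.Perm (Fin n), ∑ σ₂ : Equiv.Perm (Fin n),
      (∑ i₁, ∑ i₂, ∑ i₃, ∑ j₁, ∑ j₂,
        star (C τ₁ i₁ i₂ i₃) * C τ₂ j₁ j₂ i₃ * R₁.entry σ₁ i₁ j₁ * R₂.entry σ₂ i₂ j₂) •
      (perm σ₁ ⊗ₜ[ℂ] perm σ₂)

end RibbonAlgebra

end

/-! Let `X`, `Y` be the matrices of the Clebsch-Gordan coefficients for `τ₁`, `τ₂`: isometric
intertwiners from `R₃` to `R₁ ⊗ R₂`. Up to normalization, `σ₁ ⊗ σ₂` has coefficient `tr (Xᴴ (D¹(σ₁)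
⊗ D²(σ₂)) Y)` in `Q`.

Left multiplication by `T_k^{(i)}` inserts a sum over `𝒞_k` into this trace. For `i = 1, 2` it is
the sum of `D^i(c)`; for `i = 3`, `D¹(c) ⊗ D²(c)` crosses `Xᴴ` and becomes `D³(c)`. Since the class
is conjugation invariant, Schur's lemma makes the sum a scalar, and its trace gives `χ(T_k) / d`
(`sum_cycleClass_mat`).

`𝒦(n)` is the centralizer of the elements `μ ⊗ μ` (`mem_ribbonAlgebra_iff`), so it is stable under
multiplication by the `T_k^{(i)}`, which commute with them. That `Q` lies in it follows from the
intertwining relations and cyclicity of the trace. Finally `Q ≠ 0`: the matrices `D(σ)` span the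
full matrix algebra, so zero coefficients would force `Y Xᴴ = 0`, hence `Y = Y Xᴴ X = 0`. -/

open scoped TensorProduct Kronecker

namespace RibbonAlgebra

variable {n : ℕ}

/-! ### Schur's lemma in matrix form -/

namespace UnitaryIrrep

variable (R : UnitaryIrrep n)

/-- The matrix `D^R(σ)`, as a monoid homomorphism into the matrix algebra. -/
def mat : Equiv.Perm (Fin n) →* Matrix (Fin R.dim) (Fin R.dim) ℂ :=
  (Matrix.unitaryGroup (Fin R.dim) ℂ).subtype.comp R.D

theorem mat_apply (σ : Equiv.Perm (Fin n)) (i j : Fin R.dim) : R.mat σ i j = R.entry σ i j := rfl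

theorem rep_apply (σ : Equiv.Perm (Fin n)) : R.rep σ = Matrix.toLin' (R.mat σ) := rfl

theorem mat_inv_mul (σ : Equiv.Perm (Fin n)) : R.mat σ⁻¹ * R.mat σ = 1 := by
  rw [← map_mul, inv_mul_cancel, map_one]

theorem mat_mul_inv (σ : Equiv.Perm (Fin n)) : R.mat σ * R.mat σ⁻¹ = 1 := by
  rw [← map_mul, mul_inv_cancel, map_one]

theorem mat_conjTranspose (σ : Equiv.Perm (Fin n)) : (R.mat σ).conjTranspose = R.mat σ⁻¹ := by
  have h : (R.mat σ).conjTranspose * R.mat σ = 1 :=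
    Matrix.mem_unitaryGroup_iff'.mp (R.D σ).2
  calc (R.mat σ).conjTranspose
      = (R.mat σ).conjTranspose * (R.mat σ * R.mat σ⁻¹) := by rw [mat_mul_inv, mul_one]
    _ = R.mat σ⁻¹ := by rw [← mul_assoc, h, one_mul]

/-- Irreducibility includes the existence of two distinct subrepresentations, impossible in
dimension zero. -/
theorem dim_ne_zero : R.dim ≠ 0 := by
  intro h
  have : IsEmpty (Fin R.dim) := by rw [h]; infer_instance
  have : (matrixRep R.D).IsIrreducible := R.irreducible
  obtain ⟨a, b, hab⟩ := exists_pair_ne (Subrepresentation (matrixRep R.D))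
  refine hab (Subrepresentation.toSubmodule_injective ?_)
  exact Subsingleton.elim _ _

theorem exists_eq_smul_one_of_commute (A : Matrix (Fin R.dim) (Fin R.dim) ℂ)
    (hA : ∀ σ, Commute A (R.mat σ)) : ∃ c : ℂ, A = c • 1 := by
  have : R.rep.IsIrreducible := R.irreducible
  let f : Representation.IntertwiningMap R.rep R.rep :=
    { Matrix.toLin' A with
      isIntertwining' := fun σ => by
        change Matrix.toLin' A ∘ₗ Matrix.toLin' (R.mat σ) = Matrix.toLin' (R.mat σ) ∘ₗ Matrix.toLin' A
        rw [← Matrix.toLin'_mul, ← Matrix.toLin'_mul, (hA σ).eq] }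
  obtain ⟨c, hc⟩ :=
    (Representation.IsIrreducible.algebraMap_intertwiningMap_bijective_of_isAlgClosed).2 f
  refine ⟨c, Matrix.toLin'.injective ?_⟩
  have h := congrArg (fun g => g.toLinearMap) hc
  change _ = Matrix.toLin' A at h
  rw [← h, map_smul, Matrix.toLin'_one]
  rfl

theorem eq_trace_div_dim_smul_one_of_commute (A : Matrix (Fin R.dim) (Fin R.dim) ℂ)
    (hA : ∀ σ, Commute A (R.mat σ)) : A = (A.trace / R.dim) • 1 := by
  obtain ⟨c, rfl⟩ := R.exists_eq_smul_one_of_commute A hA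
  have := R.dim_ne_zero
  rw [Matrix.trace_smul, Matrix.trace_one, Fintype.card_fin, smul_eq_mul,
    mul_div_cancel_right₀ _ (Nat.cast_ne_zero.mpr this)]

theorem commute_sum_conj (A : Matrix (Fin R.dim) (Fin R.dim) ℂ) (σ : Equiv.Perm (Fin n)) :
    Commute (∑ g, R.mat g * A * R.mat g⁻¹) (R.mat σ) := by
  rw [commute_iff_eq, Finset.sum_mul, Finset.mul_sum]
  refine (Fintype.sum_equiv (Equiv.mulLeft σ) _ _ fun g => ?_).symm
  simp only [Equiv.coe_mulLeft, mul_inv_rev, map_mul, mul_assoc, mat_inv_mul, mul_one]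

/-- The average commutes with the representation, hence is scalar; each of the `n!` conjugates
contributes `tr A` to its trace. -/
theorem sum_conj (A : Matrix (Fin R.dim) (Fin R.dim) ℂ) :
    ∑ g, R.mat g * A * R.mat g⁻¹ = ((n.factorial : ℂ) * A.trace / R.dim) • 1 := by
  rw [R.eq_trace_div_dim_smul_one_of_commute _ (R.commute_sum_conj A), Matrix.trace_sum]
  simp only [Matrix.trace_mul_cycle, mat_inv_mul, one_mul]
  simp [Fintype.card_perm]

/-- Schur orthogonality: the matrix units are combinations of the matrices `D^R(σ)`. -/
theorem sum_entry_inv_smul_mat (i j : Fin R.dim) :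
    ∑ g, R.mat g⁻¹ j i • R.mat g = ((n.factorial : ℂ) / R.dim) • Matrix.single i j 1 := by
  ext a b
  -- Averaging the matrix unit `E_{bj}` and reading entry `(a, i)` produces exactly the products
  -- `D(g⁻¹)_{ji} D(g)_{ab}`.
  have h := congrFun (congrFun (R.sum_conj (Matrix.single b j 1)) a) i
  rw [Matrix.sum_apply] at h ⊢
  have key : ∀ g, (R.mat g * Matrix.single b j (1 : ℂ) * R.mat g⁻¹) a i
      = R.mat g⁻¹ j i * R.mat g a b := fun g => by
    rw [Matrix.mul_assoc, Matrix.mul_apply, Finset.sum_eq_single b]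
    · simp [mul_comm]
    · intro c _ hc
      simp [hc]
    · simp
  simp only [key] at h
  simp only [Matrix.smul_apply, smul_eq_mul]
  rw [h]
  by_cases hbj : b = j
  · subst hbj
    simp [Matrix.one_apply, Matrix.single_apply, eq_comm]
  · simp [Matrix.trace_single_eq_of_ne _ _ _ hbj, Ne.symm hbj]

theorem span_range_mat : Submodule.span ℂ (Set.range R.mat) = ⊤ := by
  rw [eq_top_iff]
  intro A _
  rw [Matrix.matrix_eq_sum_single A]
  refine Submodule.sum_mem _ fun i _ => Submodule.sum_mem _ fun j _ => ?_
  have hc : (n.factorial : ℂ) / R.dim ≠ 0 :=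
    div_ne_zero (Nat.cast_ne_zero.mpr n.factorial_ne_zero) (Nat.cast_ne_zero.mpr R.dim_ne_zero)
  have h : Matrix.single i j (A i j)
      = (A i j * ((n.factorial : ℂ) / R.dim)⁻¹) • ∑ g, R.mat g⁻¹ j i • R.mat g := by
    rw [sum_entry_inv_smul_mat, smul_smul, inv_mul_cancel_right₀ hc, Matrix.smul_single,
      smul_eq_mul, mul_one]
  rw [h]
  exact Submodule.smul_mem _ _ (Submodule.sum_mem _ fun g _ =>
    Submodule.smul_mem _ _ (Submodule.subset_span ⟨g, rfl⟩))

end UnitaryIrrep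

/-! ### The classes of `k`-cycles -/

theorem mem_cycleClass {k : ℕ} {σ : Equiv.Perm (Fin n)} :
    σ ∈ cycleClass n k ↔ σ.cycleType = {k} := by
  simp [cycleClass]

/-- Inversion preserves cycle type. This absorbs the `c⁻¹` created when left multiplication by `c`
is moved onto coefficients. -/
theorem sum_cycleClass_inv {M : Type*} [AddCommMonoid M] (k : ℕ) (f : Equiv.Perm (Fin n) → M) :
    ∑ c ∈ cycleClass n k, f c⁻¹ = ∑ c ∈ cycleClass n k, f c :=
  Finset.sum_equiv (Equiv.inv _) (by simp [mem_cycleClass]) (by simp)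

theorem sum_cycleClass_conj {M : Type*} [AddCommMonoid M] (k : ℕ) (μ : Equiv.Perm (Fin n))
    (f : Equiv.Perm (Fin n) → M) :
    ∑ c ∈ cycleClass n k, f (μ * c * μ⁻¹) = ∑ c ∈ cycleClass n k, f c :=
  Finset.sum_equiv (MulAut.conj μ).toEquiv (by simp [mem_cycleClass]) (by simp)

namespace UnitaryIrrep

variable (R : UnitaryIrrep n)

theorem char_cycleSum (k : ℕ) :
    R.char (cycleSum n k) = (∑ c ∈ cycleClass n k, R.mat c).trace := by
  rw [char, cycleSum, map_sum, map_sum, Matrix.trace_sum]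
  refine Finset.sum_congr rfl fun c _ => ?_
  rw [Representation.asAlgebraHom_of, rep_apply, Matrix.trace_toLin'_eq]

theorem sum_cycleClass_mat (k : ℕ) :
    ∑ c ∈ cycleClass n k, R.mat c = (R.char (cycleSum n k) / R.dim) • 1 := by
  rw [char_cycleSum]
  refine R.eq_trace_div_dim_smul_one_of_commute _ fun σ => ?_
  rw [commute_iff_eq]
  conv_lhs => rw [← sum_cycleClass_conj k σ]
  rw [Finset.sum_mul, Finset.mul_sum]
  refine Finset.sum_congr rfl fun c _ => ?_
  rw [← map_mul, ← map_mul, inv_mul_cancel_right]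

end UnitaryIrrep

/-! ### `𝒦(n)` is the centralizer of the diagonal `S_n` -/

/-- The basis element `σ₁ ⊗ σ₂` of `ℂ(S_n) ⊗ ℂ(S_n)`. -/
noncomputable abbrev pair (σ₁ σ₂ : Equiv.Perm (Fin n)) : GroupAlg n ⊗[ℂ] GroupAlg n := perm σ₁ ⊗ₜ[ℂ] perm σ₂

theorem pair_mul_pair (a b c d : Equiv.Perm (Fin n)) :
    pair a b * pair c d = pair (a * c) (b * d) := by
  simp only [pair, perm, Algebra.TensorProduct.tmul_mul_tmul, map_mul]

theorem pair_one : pair (1 : Equiv.Perm (Fin n)) 1 = 1 := by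
  simp only [pair, perm, map_one, Algebra.TensorProduct.one_def]

/-- The basis of `ℂ(S_n) ⊗ ℂ(S_n)` formed by the elements `σ₁ ⊗ σ₂`. -/
noncomputable def pairBasis (n : ℕ) : Module.Basis (Equiv.Perm (Fin n) × Equiv.Perm (Fin n)) ℂ
    (GroupAlg n ⊗[ℂ] GroupAlg n) :=
  (MonoidAlgebra.basis (Equiv.Perm (Fin n)) ℂ).tensorProduct
    (MonoidAlgebra.basis (Equiv.Perm (Fin n)) ℂ)

theorem coe_pairBasis : ⇑(pairBasis n) = fun σ => pair σ.1 σ.2 := by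
  ext1 σ
  exact (Module.Basis.tensorProduct_apply' _ _ σ).trans (by simp [pair, perm])

theorem linearIndependent_pair :
    LinearIndependent ℂ fun σ : Equiv.Perm (Fin n) × Equiv.Perm (Fin n) => pair σ.1 σ.2 :=
  coe_pairBasis (n := n) ▸ (pairBasis n).linearIndependent

theorem span_range_pair : Submodule.span ℂ
    (Set.range fun σ : Equiv.Perm (Fin n) × Equiv.Perm (Fin n) => pair σ.1 σ.2) = ⊤ :=
  coe_pairBasis (n := n) ▸ (pairBasis n).span_eq

/-- The average of `x` over simultaneous conjugation. -/
noncomputable def conjAverage (n : ℕ) : GroupAlg n ⊗[ℂ] GroupAlg n →ₗ[ℂ] GroupAlg n ⊗[ℂ] GroupAlg n :=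
  (1 / (n.factorial : ℂ)) • ∑ μ : Equiv.Perm (Fin n),
    LinearMap.mulLeftRight ℂ (pair μ μ, pair μ⁻¹ μ⁻¹)

theorem conjAverage_apply (x : GroupAlg n ⊗[ℂ] GroupAlg n) :
    conjAverage n x = (1 / (n.factorial : ℂ)) • ∑ μ : Equiv.Perm (Fin n),
      pair μ μ * x * pair μ⁻¹ μ⁻¹ := by
  simp [conjAverage, LinearMap.sum_apply]

theorem conjAverage_pair (σ₁ σ₂ : Equiv.Perm (Fin n)) :
    conjAverage n (pair σ₁ σ₂) = ribbonElement n σ₁ σ₂ := by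
  simp only [conjAverage_apply, pair_mul_pair, ribbonElement]

theorem range_conjAverage : LinearMap.range (conjAverage n) = ribbonAlgebra n := by
  rw [LinearMap.range_eq_map, ← span_range_pair, Submodule.map_span, ← Set.range_comp]
  simp only [Function.comp_def, conjAverage_pair, ribbonAlgebra]

/-- `conjAverage` is a projection onto the centralizer: averages commute with each `μ ⊗ μ` by
reindexing, and an element of the centralizer is its own average. -/
theorem mem_ribbonAlgebra_iff {x : GroupAlg n ⊗[ℂ] GroupAlg n} :
    x ∈ ribbonAlgebra n ↔ ∀ μ : Equiv.Perm (Fin n), Commute (pair μ μ) x := by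
  rw [← range_conjAverage]
  constructor
  · rintro ⟨y, rfl⟩ μ
    rw [commute_iff_eq, conjAverage_apply, mul_smul_comm, smul_mul_assoc, Finset.mul_sum,
      Finset.sum_mul]
    congr 1
    refine Fintype.sum_equiv (Equiv.mulLeft μ) _ _ fun g => ?_
    simp only [Equiv.coe_mulLeft, mul_assoc, pair_mul_pair, mul_inv_rev, inv_mul_cancel, mul_one]
    simp only [← mul_assoc, pair_mul_pair]
  · intro h
    refine ⟨x, ?_⟩
    rw [conjAverage_apply]
    have key : ∀ μ : Equiv.Perm (Fin n), pair μ μ * x * pair μ⁻¹ μ⁻¹ = x := fun μ => by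
      rw [(h μ).eq, mul_assoc, pair_mul_pair, mul_inv_cancel, pair_one, mul_one]
    simp only [key, Finset.sum_const, Finset.card_univ, Fintype.card_perm, Fintype.card_fin]
    rw [← Nat.cast_smul_eq_nsmul ℂ, smul_smul,
      one_div_mul_cancel (Nat.cast_ne_zero.mpr n.factorial_ne_zero), one_smul]

/-! ### The operators `T_k^{(i)}` -/

theorem reconnection_zero (k : ℕ) :
    reconnection n k 0 = ∑ c ∈ cycleClass n k, pair c 1 := by
  simp [reconnection, cycleSum, TensorProduct.sum_tmul, pair, MonoidAlgebra.one_def]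

theorem reconnection_one (k : ℕ) :
    reconnection n k 1 = ∑ c ∈ cycleClass n k, pair 1 c := by
  simp [reconnection, cycleSum, TensorProduct.tmul_sum, pair, MonoidAlgebra.one_def]

theorem reconnection_two (k : ℕ) :
    reconnection n k 2 = ∑ c ∈ cycleClass n k, pair c c := rfl

theorem commute_sum_cycleClass (k : ℕ) (μ : Equiv.Perm (Fin n))
    (f : Equiv.Perm (Fin n) → GroupAlg n ⊗[ℂ] GroupAlg n)
    (hf : ∀ c, f (μ * c * μ⁻¹) * pair μ μ = pair μ μ * f c) :
    Commute (pair μ μ) (∑ c ∈ cycleClass n k, f c) := by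
  rw [commute_iff_eq]
  conv_rhs => rw [← sum_cycleClass_conj k μ]
  rw [Finset.sum_mul, Finset.mul_sum]
  exact Finset.sum_congr rfl fun c _ => (hf c).symm

theorem commute_reconnection (k : ℕ) (i : Fin 3) (μ : Equiv.Perm (Fin n)) :
    Commute (pair μ μ) (reconnection n k i) := by
  fin_cases i
  · change Commute _ (reconnection n k 0)
    rw [reconnection_zero]
    exact commute_sum_cycleClass k μ (fun c => pair c 1) fun c => by simp
  · change Commute _ (reconnection n k 1)
    rw [reconnection_one]
    exact commute_sum_cycleClass k μ (fun c => pair 1 c) fun c => by simp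
  · change Commute _ (reconnection n k 2)
    rw [reconnection_two]
    exact commute_sum_cycleClass k μ (fun c => pair c c) fun c => by simp

/-! ### Combinations of the basis elements `σ₁ ⊗ σ₂` -/

/-- The element of `ℂ(S_n) ⊗ ℂ(S_n)` with coefficients `f`. -/
noncomputable def ofCoeff (f : Equiv.Perm (Fin n) → Equiv.Perm (Fin n) → ℂ) : GroupAlg n ⊗[ℂ] GroupAlg n :=
  ∑ σ₁, ∑ σ₂, f σ₁ σ₂ • pair σ₁ σ₂

theorem ofCoeff_ne_zero {f : Equiv.Perm (Fin n) → Equiv.Perm (Fin n) → ℂ}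
    (hf : f ≠ 0) : ofCoeff f ≠ 0 := by
  intro h
  rw [ofCoeff, ← Fintype.sum_prod_type' (f := fun a b => f a b • pair a b)] at h
  have := Fintype.linearIndependent_iff.mp linearIndependent_pair (fun σ => f σ.1 σ.2) h
  exact hf (funext fun a => funext fun b => this (a, b))

theorem pair_mul_ofCoeff (a b : Equiv.Perm (Fin n))
    (f : Equiv.Perm (Fin n) → Equiv.Perm (Fin n) → ℂ) :
    pair a b * ofCoeff f = ofCoeff fun σ₁ σ₂ => f (a⁻¹ * σ₁) (b⁻¹ * σ₂) := by
  simp only [ofCoeff, Finset.mul_sum, mul_smul_comm, pair_mul_pair]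
  refine Fintype.sum_equiv (Equiv.mulLeft a) _ _ fun σ₁ =>
    Fintype.sum_equiv (Equiv.mulLeft b) _ _ fun σ₂ => ?_
  simp

theorem ofCoeff_mul_pair (a b : Equiv.Perm (Fin n))
    (f : Equiv.Perm (Fin n) → Equiv.Perm (Fin n) → ℂ) :
    ofCoeff f * pair a b = ofCoeff fun σ₁ σ₂ => f (σ₁ * a⁻¹) (σ₂ * b⁻¹) := by
  simp only [ofCoeff, Finset.sum_mul, smul_mul_assoc, pair_mul_pair]
  refine Fintype.sum_equiv (Equiv.mulRight a) _ _ fun σ₁ =>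
    Fintype.sum_equiv (Equiv.mulRight b) _ _ fun σ₂ => ?_
  simp

theorem sum_ofCoeff {ι : Type*} (s : Finset ι)
    (f : ι → Equiv.Perm (Fin n) → Equiv.Perm (Fin n) → ℂ) :
    ∑ c ∈ s, ofCoeff (f c) = ofCoeff fun σ₁ σ₂ => ∑ c ∈ s, f c σ₁ σ₂ := by
  simp only [ofCoeff, Finset.sum_smul]
  rw [Finset.sum_comm]
  exact Finset.sum_congr rfl fun _ _ => Finset.sum_comm

theorem smul_ofCoeff (c : ℂ) (f : Equiv.Perm (Fin n) → Equiv.Perm (Fin n) → ℂ) :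
    c • ofCoeff f = ofCoeff fun σ₁ σ₂ => c * f σ₁ σ₂ := by
  simp only [ofCoeff, Finset.smul_sum, smul_smul]

/-! ### Clebsch-Gordan matrices and the Fourier basis elements -/

/-- The bilinear form `(A, B) ↦ tr (Xᴴ (A ⊗ B) Y)`. -/
def kroneckerForm {p q r : ℕ} (X Y : Matrix (Fin p × Fin q) (Fin r) ℂ) :
    Matrix (Fin p) (Fin p) ℂ →ₗ[ℂ] Matrix (Fin q) (Fin q) ℂ →ₗ[ℂ] ℂ :=
  LinearMap.mk₂ ℂ (fun A B => (X.conjTranspose * (A ⊗ₖ B) * Y).trace)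
    (fun A A' B => by
      rw [Matrix.add_kronecker, Matrix.mul_add, Matrix.add_mul, Matrix.trace_add])
    (fun c A B => by
      rw [Matrix.smul_kronecker, Matrix.mul_smul, Matrix.smul_mul, Matrix.trace_smul])
    (fun A B B' => by
      rw [Matrix.kronecker_add, Matrix.mul_add, Matrix.add_mul, Matrix.trace_add])
    (fun c A B => by
      rw [Matrix.kronecker_smul, Matrix.mul_smul, Matrix.smul_mul, Matrix.trace_smul])

theorem kroneckerForm_apply {p q r : ℕ} (X Y : Matrix (Fin p × Fin q) (Fin r) ℂ)
    (A : Matrix (Fin p) (Fin p) ℂ) (B : Matrix (Fin q) (Fin q) ℂ) :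
    kroneckerForm X Y A B = (X.conjTranspose * (A ⊗ₖ B) * Y).trace := rfl

/-- Evaluated at the matrix units `E_{ac}`, `E_{bd}`, the form returns the entry of `Y Xᴴ` at `((c,
d), (a, b))`. -/
theorem mul_conjTranspose_eq_zero_of_kroneckerForm_eq_zero {p q r : ℕ}
    {X Y : Matrix (Fin p × Fin q) (Fin r) ℂ} (h : kroneckerForm X Y = 0) :
    Y * X.conjTranspose = 0 := by
  ext ⟨c, d⟩ ⟨a, b⟩
  have h1 := LinearMap.congr_fun₂ h (Matrix.single a c 1) (Matrix.single b d 1)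
  rw [kroneckerForm_apply, Matrix.single_kronecker_single, Matrix.trace_mul_cycle,
    Matrix.trace_mul_comm, Matrix.trace_single_mul] at h1
  simpa using h1

/-- The coefficients `C^{R₁,R₂;R₃,τ}`, as a matrix with rows indexed by pairs. -/
def cgMatrix {p q r : ℕ} (C : Fin p → Fin q → Fin r → ℂ) : Matrix (Fin p × Fin q) (Fin r) ℂ :=
  Matrix.of fun i j => C i.1 i.2 j

variable {R₁ R₂ R₃ : UnitaryIrrep n}
  {C : Fin (kroneckerCoeff R₁ R₂ R₃) → Fin R₁.dim → Fin R₂.dim → Fin R₃.dim → ℂ}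

theorem IsClebschGordan.kronecker_mul (hC : IsClebschGordan R₁ R₂ R₃ C)
    (τ : Fin (kroneckerCoeff R₁ R₂ R₃)) (γ : Equiv.Perm (Fin n)) :
    (R₁.mat γ ⊗ₖ R₂.mat γ) * cgMatrix (C τ) = cgMatrix (C τ) * R₃.mat γ := by
  ext ⟨i₁, i₂⟩ j
  simp only [Matrix.mul_apply, Fintype.sum_prod_type, Matrix.kroneckerMap_apply, cgMatrix,
    Matrix.of_apply, UnitaryIrrep.mat_apply]
  exact hC.intertwines τ γ i₁ i₂ j

/-- By unitarity, this is the adjoint of the intertwining relation at `γ⁻¹`. -/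
theorem IsClebschGordan.conjTranspose_mul_kronecker (hC : IsClebschGordan R₁ R₂ R₃ C)
    (τ : Fin (kroneckerCoeff R₁ R₂ R₃)) (γ : Equiv.Perm (Fin n)) :
    (cgMatrix (C τ)).conjTranspose * (R₁.mat γ ⊗ₖ R₂.mat γ)
      = R₃.mat γ * (cgMatrix (C τ)).conjTranspose := by
  have h := congrArg Matrix.conjTranspose (hC.kronecker_mul τ γ⁻¹)
  simpa only [Matrix.conjTranspose_mul, Matrix.conjTranspose_kronecker,
    UnitaryIrrep.mat_conjTranspose, inv_inv] using h

theorem IsClebschGordan.conjTranspose_mul_self (hC : IsClebschGordan R₁ R₂ R₃ C)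
    (τ : Fin (kroneckerCoeff R₁ R₂ R₃)) :
    (cgMatrix (C τ)).conjTranspose * cgMatrix (C τ) = 1 := by
  ext i j
  have h := hC.orthonormal τ τ i j
  simpa only [Matrix.mul_apply, Fintype.sum_prod_type, cgMatrix, Matrix.conjTranspose_apply,
    Matrix.of_apply, true_and, Matrix.one_apply] using h

/-- The coefficient of `σ₁ ⊗ σ₂` in the Fourier basis element, up to normalization. -/
def fourierCoeff (C : Fin (kroneckerCoeff R₁ R₂ R₃) → Fin R₁.dim → Fin R₂.dim → Fin R₃.dim → ℂ)
    (τ₁ τ₂ : Fin (kroneckerCoeff R₁ R₂ R₃)) (σ₁ σ₂ : Equiv.Perm (Fin n)) : ℂ :=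
  kroneckerForm (cgMatrix (C τ₁)) (cgMatrix (C τ₂)) (R₁.mat σ₁) (R₂.mat σ₂)

theorem fourierCoeff_eq_sum (τ₁ τ₂ : Fin (kroneckerCoeff R₁ R₂ R₃))
    (σ₁ σ₂ : Equiv.Perm (Fin n)) :
    fourierCoeff C τ₁ τ₂ σ₁ σ₂ = ∑ i₁, ∑ i₂, ∑ i₃, ∑ j₁, ∑ j₂,
      star (C τ₁ i₁ i₂ i₃) * C τ₂ j₁ j₂ i₃ * R₁.entry σ₁ i₁ j₁ * R₂.entry σ₂ i₂ j₂ := by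
  rw [fourierCoeff, kroneckerForm_apply, Matrix.mul_assoc, Matrix.trace]
  simp only [Matrix.diag_apply, Matrix.mul_apply, Fintype.sum_prod_type,
    Matrix.kroneckerMap_apply, cgMatrix, Matrix.conjTranspose_apply, Matrix.of_apply,
    UnitaryIrrep.mat_apply, Finset.mul_sum]
  -- The trace index `i₃` is outermost; two exchanges carry it past `i₁` and `i₂`.
  rw [Finset.sum_comm]
  refine Finset.sum_congr rfl fun i₁ _ => ?_
  rw [Finset.sum_comm]
  refine Finset.sum_congr rfl fun i₂ _ => Finset.sum_congr rfl fun i₃ _ =>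
    Finset.sum_congr rfl fun j₁ _ => Finset.sum_congr rfl fun j₂ _ => ?_
  ring

theorem fourierElement_eq (τ₁ τ₂ : Fin (kroneckerCoeff R₁ R₂ R₃)) :
    fourierElement R₁ R₂ R₃ C τ₁ τ₂ =
      ((R₁.dim : ℂ) * (R₂.dim : ℂ) / (n.factorial : ℂ) ^ 2) • ofCoeff (fourierCoeff C τ₁ τ₂) := by
  simp only [fourierElement, ofCoeff, fourierCoeff_eq_sum]

theorem IsClebschGordan.fourierCoeff_ne_zero (hC : IsClebschGordan R₁ R₂ R₃ C)
    (τ₁ τ₂ : Fin (kroneckerCoeff R₁ R₂ R₃)) : fourierCoeff C τ₁ τ₂ ≠ 0 := by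
  intro h
  have hform : kroneckerForm (cgMatrix (C τ₁)) (cgMatrix (C τ₂)) = 0 := by
    refine LinearMap.ext_on_range R₁.span_range_mat fun σ₁ => ?_
    refine LinearMap.ext_on_range R₂.span_range_mat fun σ₂ => ?_
    exact congrFun (congrFun h σ₁) σ₂
  have h0 := mul_conjTranspose_eq_zero_of_kroneckerForm_eq_zero hform
  have h2 : cgMatrix (C τ₂) = 0 := by
    rw [← Matrix.mul_one (cgMatrix (C τ₂)), ← hC.conjTranspose_mul_self τ₁, ← Matrix.mul_assoc,
      h0, Matrix.zero_mul]
  have h1 := hC.conjTranspose_mul_self τ₂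
  rw [h2, Matrix.mul_zero] at h1
  have i : Fin R₃.dim := ⟨0, Nat.pos_of_ne_zero R₃.dim_ne_zero⟩
  simpa using congrFun (congrFun h1 i) i

theorem IsClebschGordan.fourierElement_ne_zero (hC : IsClebschGordan R₁ R₂ R₃ C)
    (τ₁ τ₂ : Fin (kroneckerCoeff R₁ R₂ R₃)) : fourierElement R₁ R₂ R₃ C τ₁ τ₂ ≠ 0 := by
  rw [fourierElement_eq]
  refine smul_ne_zero (div_ne_zero (mul_ne_zero ?_ ?_) (pow_ne_zero 2 ?_))
    (ofCoeff_ne_zero (hC.fourierCoeff_ne_zero τ₁ τ₂))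
  · exact Nat.cast_ne_zero.mpr R₁.dim_ne_zero
  · exact Nat.cast_ne_zero.mpr R₂.dim_ne_zero
  · exact Nat.cast_ne_zero.mpr n.factorial_ne_zero

theorem IsClebschGordan.fourierElement_mem (hC : IsClebschGordan R₁ R₂ R₃ C)
    (τ₁ τ₂ : Fin (kroneckerCoeff R₁ R₂ R₃)) :
    fourierElement R₁ R₂ R₃ C τ₁ τ₂ ∈ ribbonAlgebra n := by
  rw [fourierElement_eq]
  refine Submodule.smul_mem _ _ (mem_ribbonAlgebra_iff.mpr fun μ => ?_)
  rw [commute_iff_eq, pair_mul_ofCoeff, ofCoeff_mul_pair]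
  congr 1
  ext σ₁ σ₂
  simp only [fourierCoeff, kroneckerForm_apply, map_mul, Matrix.mul_kronecker_mul]
  -- On one side `μ⁻¹` leaves through `Xᴴ`, on the other through `Y`; both become `D³(μ⁻¹)`, at
  -- opposite ends of the trace.
  rw [← Matrix.mul_assoc, hC.conjTranspose_mul_kronecker, ← Matrix.mul_assoc,
    Matrix.mul_assoc _ (R₁.mat μ⁻¹ ⊗ₖ R₂.mat μ⁻¹), hC.kronecker_mul]
  simp only [Matrix.mul_assoc]
  rw [Matrix.trace_mul_comm]
  simp only [Matrix.mul_assoc]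

/-! ### Eigenvalue equations -/

theorem sum_cycleClass_fourierCoeff_left (k : ℕ) (τ₁ τ₂ : Fin (kroneckerCoeff R₁ R₂ R₃))
    (σ₁ σ₂ : Equiv.Perm (Fin n)) :
    ∑ c ∈ cycleClass n k, fourierCoeff C τ₁ τ₂ (c⁻¹ * σ₁) σ₂
      = R₁.char (cycleSum n k) / R₁.dim * fourierCoeff C τ₁ τ₂ σ₁ σ₂ := by
  rw [sum_cycleClass_inv k fun c => fourierCoeff C τ₁ τ₂ (c * σ₁) σ₂]
  simp only [fourierCoeff, map_mul]
  rw [← LinearMap.sum_apply, ← map_sum, ← Finset.sum_mul, R₁.sum_cycleClass_mat, smul_mul_assoc,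
    one_mul, map_smul, LinearMap.smul_apply, smul_eq_mul]

theorem sum_cycleClass_fourierCoeff_right (k : ℕ) (τ₁ τ₂ : Fin (kroneckerCoeff R₁ R₂ R₃))
    (σ₁ σ₂ : Equiv.Perm (Fin n)) :
    ∑ c ∈ cycleClass n k, fourierCoeff C τ₁ τ₂ σ₁ (c⁻¹ * σ₂)
      = R₂.char (cycleSum n k) / R₂.dim * fourierCoeff C τ₁ τ₂ σ₁ σ₂ := by
  rw [sum_cycleClass_inv k fun c => fourierCoeff C τ₁ τ₂ σ₁ (c * σ₂)]
  simp only [fourierCoeff, map_mul]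
  rw [← map_sum, ← Finset.sum_mul, R₂.sum_cycleClass_mat, smul_mul_assoc,
    one_mul, map_smul, smul_eq_mul]

theorem IsClebschGordan.sum_cycleClass_fourierCoeff_diag (hC : IsClebschGordan R₁ R₂ R₃ C) (k : ℕ)
    (τ₁ τ₂ : Fin (kroneckerCoeff R₁ R₂ R₃)) (σ₁ σ₂ : Equiv.Perm (Fin n)) :
    ∑ c ∈ cycleClass n k, fourierCoeff C τ₁ τ₂ (c⁻¹ * σ₁) (c⁻¹ * σ₂)
      = R₃.char (cycleSum n k) / R₃.dim * fourierCoeff C τ₁ τ₂ σ₁ σ₂ := by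
  rw [sum_cycleClass_inv k fun c => fourierCoeff C τ₁ τ₂ (c * σ₁) (c * σ₂)]
  simp only [fourierCoeff, kroneckerForm_apply, map_mul, Matrix.mul_kronecker_mul]
  simp only [← Matrix.mul_assoc, hC.conjTranspose_mul_kronecker]
  simp only [Matrix.mul_assoc]
  rw [← Matrix.trace_sum, ← Finset.sum_mul, R₃.sum_cycleClass_mat, smul_mul_assoc, one_mul,
    Matrix.trace_smul, smul_eq_mul]

/-- Choosing each of `a`, `b` to be the identity map or constantly `1` covers all three operators.
-/
theorem sum_pair_mul_fourierElement (k : ℕ) (τ₁ τ₂ : Fin (kroneckerCoeff R₁ R₂ R₃))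
    (a b : Equiv.Perm (Fin n) → Equiv.Perm (Fin n)) (c : ℂ)
    (h : ∀ σ₁ σ₂, ∑ g ∈ cycleClass n k, fourierCoeff C τ₁ τ₂ ((a g)⁻¹ * σ₁) ((b g)⁻¹ * σ₂)
      = c * fourierCoeff C τ₁ τ₂ σ₁ σ₂) :
    (∑ g ∈ cycleClass n k, pair (a g) (b g)) * fourierElement R₁ R₂ R₃ C τ₁ τ₂
      = c • fourierElement R₁ R₂ R₃ C τ₁ τ₂ := by
  rw [fourierElement_eq, mul_smul_comm, smul_comm c, Finset.sum_mul]
  simp only [pair_mul_ofCoeff, sum_ofCoeff, h, smul_ofCoeff]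

end RibbonAlgebra

open RibbonAlgebra in
theorem RibbonAlgebra.IsClebschGordan.reconnection_mul_fourierElement {n : ℕ}
    {R : Fin 3 → UnitaryIrrep n}
    {C : Fin (kroneckerCoeff (R 0) (R 1) (R 2)) →
      Fin (R 0).dim → Fin (R 1).dim → Fin (R 2).dim → ℂ}
    (hC : IsClebschGordan (R 0) (R 1) (R 2) C) (k : ℕ)
    (τ₁ τ₂ : Fin (kroneckerCoeff (R 0) (R 1) (R 2))) (i : Fin 3) :
    reconnection n k i * fourierElement (R 0) (R 1) (R 2) C τ₁ τ₂
      = ((R i).char (cycleSum n k) / ((R i).dim : ℂ)) •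
        fourierElement (R 0) (R 1) (R 2) C τ₁ τ₂ := by
  match i with
  | 0 =>
    rw [reconnection_zero]
    exact sum_pair_mul_fourierElement k τ₁ τ₂ (fun c => c) (fun _ => 1) _ fun σ₁ σ₂ => by
      simpa using sum_cycleClass_fourierCoeff_left k τ₁ τ₂ σ₁ σ₂
  | 1 =>
    rw [reconnection_one]
    exact sum_pair_mul_fourierElement k τ₁ τ₂ (fun _ => 1) (fun c => c) _ fun σ₁ σ₂ => by
      simpa using sum_cycleClass_fourierCoeff_right k τ₁ τ₂ σ₁ σ₂
  | 2 =>
    rw [reconnection_two]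
    exact sum_pair_mul_fourierElement k τ₁ τ₂ (fun c => c) (fun c => c) _ fun σ₁ σ₂ =>
      hC.sum_cycleClass_fourierCoeff_diag k τ₁ τ₂ σ₁ σ₂

theorem mainTheorem5 (n k : ℕ) (hk : 2 ≤ k) (hkn : k ≤ n)
    (R : Fin 3 → RibbonAlgebra.UnitaryIrrep n)
    (C : Fin (RibbonAlgebra.kroneckerCoeff (R 0) (R 1) (R 2)) →
      Fin (R 0).dim → Fin (R 1).dim → Fin (R 2).dim → ℂ)
    (hC : RibbonAlgebra.IsClebschGordan (R 0) (R 1) (R 2) C)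
    (τ₁ τ₂ : Fin (RibbonAlgebra.kroneckerCoeff (R 0) (R 1) (R 2))) (i : Fin 3) :
    ∃ (hT : ∀ x ∈ RibbonAlgebra.ribbonAlgebra n,
        LinearMap.mulLeft ℂ (RibbonAlgebra.reconnection n k i) x ∈ RibbonAlgebra.ribbonAlgebra n)
      (hQ : RibbonAlgebra.fourierElement (R 0) (R 1) (R 2) C τ₁ τ₂ ∈
        RibbonAlgebra.ribbonAlgebra n),
      Module.End.HasEigenvector (M := RibbonAlgebra.ribbonAlgebra n)
        ((LinearMap.mulLeft ℂ (RibbonAlgebra.reconnection n k i)).restrict hT)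
        ((R i).char (RibbonAlgebra.cycleSum n k) / ((R i).dim : ℂ))
        ⟨RibbonAlgebra.fourierElement (R 0) (R 1) (R 2) C τ₁ τ₂, hQ⟩ := by

  have hT : ∀ x ∈ RibbonAlgebra.ribbonAlgebra n,
      LinearMap.mulLeft ℂ (RibbonAlgebra.reconnection n k i) x ∈ RibbonAlgebra.ribbonAlgebra n :=
    fun x hx => RibbonAlgebra.mem_ribbonAlgebra_iff.mpr fun μ =>
      (RibbonAlgebra.commute_reconnection k i μ).mul_right
        (RibbonAlgebra.mem_ribbonAlgebra_iff.mp hx μ)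
  refine ⟨hT, hC.fourierElement_mem τ₁ τ₂, ?_⟩
  rw [Module.End.hasEigenvector_iff, Module.End.mem_eigenspace_iff]
  refine ⟨Subtype.ext (hC.reconnection_mul_fourierElement k τ₁ τ₂ i), fun h => ?_⟩
  exact hC.fourierElement_ne_zero τ₁ τ₂ (congrArg Subtype.val h)
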